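/- Let $q,\alpha,\beta\in\mathbb{C}$ with $|q|<1$, $|\alpha|<1$, $|\beta|<1$. Write $(a;q)_n=\prod_{k=0}^{n-1}(1-aq^k)$ for $n\ge 0$ (with $(a;q)_0=1$), $(a;q)_\infty=\prod_{k=0}^{\infty}(1-aq^k)$, and $(a,b;q)_\infty=(a;q)_\infty(b;q)_\infty$. For $\theta\in\mathbb{R}$ let the functions $C_n^{(\alpha,\beta)}(e^{i\theta};q)$, $n\ge 0$, be defined by the generating function $$\frac{(\alpha te^{i\theta},\beta te^{-i\theta};q)_\infty}{(te^{i\theta},te^{-i\theta};q)_\infty}=\sum_{n=0}^{\infty}C_n^{(\alpha,\beta)}(e^{i\theta};q)\,t^n,\qquad |t|<1,$$ that is, $C_n^{(\alpha,\beta)}(e^{i\theta};q)$ is the $n$-th Taylor coefficient at $t=0$ of the left-hand side, whose Taylor series converges to it for $|t|<1$. Then for all integers $m,n\ge 0$ the integrand below is integrable on $[0,2\pi]$, and $$\int_{0}^{2\pi}C_m^{(\alpha,\beta)}(e^{i\theta};q)\,C_n^{(\alpha,\beta)}(e^{i\theta};q)\,\frac{(e^{2i\theta},e^{-2i\theta};q)_\infty}{(\alpha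 e^{2i\theta},\beta e^{-2i\theta};q)_\infty}\,d\theta =\frac{2\pi(\alpha,\beta;q)_\infty}{(q,\alpha\beta;q)_\infty}\left(\frac{1}{1-\alpha q^n}+\frac{1}{1-\beta q^n}\right)\frac{(\alpha\beta;q)_n}{(q;q)_n}\,\delta_{m,n},$$ where $\delta_{m,n}=1$ if $m=n$ and $0$ otherwise. -/

import Mathlib

namespace QOrth

/-- The finite `q`-shifted factorial `(a;q)_n = ∏_{k=0}^{n-1} (1 - a q^k)`. -/
noncomputable def qPoch (a q : ℂ) (n : ℕ) : ℂ :=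
  ∏ k ∈ Finset.range n, (1 - a * q ^ k)

/-- The infinite `q`-shifted factorial `(a;q)_∞ = ∏_{k=0}^∞ (1 - a q^k)`
(the product converges unconditionally for `|q| < 1`). -/
noncomputable def qPochInf (a q : ℂ) : ℂ :=
  ∏' k : ℕ, (1 - a * q ^ k)

/-- The generating function
`(α t z, β t z⁻¹; q)_∞ / (t z, t z⁻¹; q)_∞`, to be used with `z = e^{iθ}`. -/
noncomputable def genFun (α β q z t : ℂ) : ℂ :=
  (qPochInf (α * t * z) q * qPochInf (β * t * z⁻¹) q) /
    (qPochInf (t * z) q * qPochInf (t * z⁻¹) q)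

/-- `C_n^{(α,β)}(z;q)`: the coefficient of `t^n` in the expansion of the generating function
in powers of `t`, i.e. its `n`-th Taylor coefficient at `t = 0`. -/
noncomputable def C (α β q : ℂ) (n : ℕ) (z : ℂ) : ℂ :=
  iteratedDeriv n (genFun α β q z) 0 / (n.factorial : ℂ)

/-- The weight `(e^{2iθ}, e^{-2iθ}; q)_∞ / (α e^{2iθ}, β e^{-2iθ}; q)_∞`. -/
noncomputable def weight (α β q : ℂ) (θ : ℝ) : ℂ :=
  (qPochInf (Complex.exp (2 * Complex.I * θ)) q *
      qPochInf (Complex.exp (-2 * Complex.I * θ)) q) /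
    (qPochInf (α * Complex.exp (2 * Complex.I * θ)) q *
      qPochInf (β * Complex.exp (-2 * Complex.I * θ)) q)

end QOrth

open Filter Topology MeasureTheory

namespace QOrth

/-! Write z = e^{iθ} and x = z². Peeling one factor off (x⁻¹;q)_∞ gives weight = (1 - x⁻¹) ψ(x),
where ψ is the kernel of Ramanujan's ₁ψ₁ sum, so everything reduces to the moments M(n,j) = ∫ C_n ψ
z^j (`integral_C_mul_weight`).

For n = 0 and j = 2i ≥ 0 the moments are Fourier coefficients of ψ. Two q-binomial expansions turn
them into a series that a q-Gauss sum evaluates (`integral_psiKernel`). The three-term recurrence of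
C_n (`C_add_two`) becomes one for M, which yields M(n, n+2i) in closed form (`moment_add_two_mul`);
the reflection z ↦ z⁻¹ carries this to negative j with α and β exchanged (`moment_symm`).

Hence M(n,j) = 0 for -n ≤ j < n (`moment_eq_zero`): inside the window the recurrence propagates
zeros, and at its ends the two surviving terms cancel. Since C_m is a Laurent polynomial with
frequencies from -m to m, the integral vanishes for m < n. For m = n only the frequencies ±n
contribute, through M(n,n) and M(n,-n-2), the sources of the two fractions in the norm. -/

/-! ### q-shifted factorials -/

theorem norm_mul_pow_lt_one {a q : ℂ} (hq : ‖q‖ < 1) (ha : ‖a‖ < 1) (k : ℕ) :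
    ‖a * q ^ k‖ < 1 := by
  rw [norm_mul, norm_pow]
  exact (mul_le_of_le_one_right (norm_nonneg _) (pow_le_one₀ (norm_nonneg _) hq.le)).trans_lt ha

theorem one_sub_ne_zero_of_norm_lt_one {a : ℂ} (ha : ‖a‖ < 1) : 1 - a ≠ 0 := by
  intro h
  have : a = 1 := (sub_eq_zero.mp h).symm
  simp [this] at ha

theorem one_sub_mul_pow_ne_zero {a q : ℂ} (hq : ‖q‖ < 1) (ha : ‖a‖ < 1) (k : ℕ) :
    1 - a * q ^ k ≠ 0 :=
  one_sub_ne_zero_of_norm_lt_one (norm_mul_pow_lt_one hq ha k)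

theorem one_sub_pow_succ_ne_zero {q : ℂ} (hq : ‖q‖ < 1) (k : ℕ) : 1 - q ^ (k + 1) ≠ 0 := by
  rw [pow_succ']
  exact one_sub_mul_pow_ne_zero hq hq k

theorem summable_norm_neg_mul_pow {q : ℂ} (hq : ‖q‖ < 1) (a : ℂ) :
    Summable fun k : ℕ => ‖-(a * q ^ k)‖ := by
  simp only [norm_neg, norm_mul, norm_pow]
  exact (summable_geometric_of_lt_one (norm_nonneg _) hq).mul_left _

theorem multipliable_one_sub_mul_pow {q : ℂ} (hq : ‖q‖ < 1) (a : ℂ) :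
    Multipliable fun k : ℕ => 1 - a * q ^ k := by
  simpa only [sub_eq_add_neg] using multipliable_one_add_of_summable
    (summable_norm_neg_mul_pow hq a)

theorem qPochInf_ne_zero {a q : ℂ} (hq : ‖q‖ < 1) (ha : ‖a‖ < 1) : qPochInf a q ≠ 0 := by
  have := tprod_one_add_ne_zero_of_summable (f := fun k : ℕ => -(a * q ^ k))
    (fun k => by simpa only [sub_eq_add_neg] using one_sub_mul_pow_ne_zero hq ha k)
    (summable_norm_neg_mul_pow hq a)
  simpa only [qPochInf, sub_eq_add_neg] using this

theorem tendsto_qPoch {q : ℂ} (hq : ‖q‖ < 1) (a : ℂ) :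
    Tendsto (qPoch a q) atTop (𝓝 (qPochInf a q)) :=
  (multipliable_one_sub_mul_pow hq a).tendsto_prod_tprod_nat

theorem qPoch_zero (a q : ℂ) : qPoch a q 0 = 1 := by simp [qPoch]

theorem qPoch_succ (a q : ℂ) (n : ℕ) : qPoch a q (n + 1) = qPoch a q n * (1 - a * q ^ n) := by
  simp [qPoch, Finset.prod_range_succ]

theorem qPoch_succ' (a q : ℂ) (n : ℕ) : qPoch a q (n + 1) = (1 - a) * qPoch (a * q) q n := by
  simp only [qPoch, Finset.prod_range_succ', pow_zero, mul_one, pow_succ']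
  rw [mul_comm]
  simp only [mul_assoc]

theorem qPoch_ne_zero {a q : ℂ} (hq : ‖q‖ < 1) (ha : ‖a‖ < 1) (n : ℕ) : qPoch a q n ≠ 0 :=
  Finset.prod_ne_zero_iff.mpr fun k _ => one_sub_mul_pow_ne_zero hq ha k

theorem qPochInf_eq_qPoch_mul {q : ℂ} (hq : ‖q‖ < 1) (a : ℂ) (n : ℕ) :
    qPochInf a q = qPoch a q n * qPochInf (a * q ^ n) q := by
  have := (Multipliable.prod_mul_tprod_nat_mul' (f := fun k : ℕ => 1 - a * q ^ k) (k := n)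
    (by simpa only [pow_add, mul_assoc, mul_comm (q ^ n)] using
      multipliable_one_sub_mul_pow hq (a * q ^ n))).symm
  simpa only [qPochInf, qPoch, pow_add, mul_assoc, mul_comm (q ^ n)] using this

theorem qPochInf_eq_one_sub_mul {q : ℂ} (hq : ‖q‖ < 1) (a : ℂ) :
    qPochInf a q = (1 - a) * qPochInf (a * q) q := by
  simpa [qPoch] using qPochInf_eq_qPoch_mul hq a 1

/-! ### The q-binomial theorem -/

/-- The coefficient of `x ^ k` in the expansion of `(a x; q)_∞ / (b x; q)_∞`. -/
noncomputable def qBinCoeff (a b q : ℂ) (k : ℕ) : ℂ :=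
  (∏ l ∈ Finset.range k, (b - a * q ^ l)) / qPoch q q k

theorem qBinCoeff_zero (a b q : ℂ) : qBinCoeff a b q 0 = 1 := by simp [qBinCoeff, qPoch]

/-- With factors b - a q^l in place of b^k (a/b;q)_k, the case b = 0 needs no separate treatment; b
will later be α or β. -/
theorem qBinCoeff_succ {q : ℂ} (hq : ‖q‖ < 1) (a b : ℂ) (k : ℕ) :
    qBinCoeff a b q (k + 1) * (1 - q ^ (k + 1)) = qBinCoeff a b q k * (b - a * q ^ k) := by
  have h1 := qPoch_ne_zero hq hq k
  have h2 := one_sub_pow_succ_ne_zero hq k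
  rw [qBinCoeff, qBinCoeff, qPoch_succ, Finset.prod_range_succ, ← pow_succ']
  field_simp

theorem summable_norm_qBinCoeff {a b q x : ℂ} (hq : ‖q‖ < 1) (hx : ‖b * x‖ < 1) :
    Summable fun k : ℕ => ‖qBinCoeff a b q k * x ^ k‖ := by
  obtain ⟨r, hr, hr1⟩ := exists_between hx
  have hqk : Tendsto (fun k : ℕ => q ^ k) atTop (𝓝 0) :=
    tendsto_pow_atTop_nhds_zero_of_norm_lt_one hq
  have hlim : Tendsto (fun k : ℕ => ‖(b - a * q ^ k) / (1 - q ^ (k + 1)) * x‖) atTop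
      (𝓝 ‖(b - a * 0) / (1 - 0) * x‖) :=
    ((((hqk.const_mul a).const_sub b).div ((hqk.comp (tendsto_add_atTop_nat 1)).const_sub 1)
      (by simp)).mul_const x).norm
  have hev := hlim.eventually_lt_const (u := r) (by simpa using hr)
  have hs : Summable fun k : ℕ => ‖qBinCoeff a b q k * x ^ k‖ := by
    apply summable_of_ratio_norm_eventually_le hr1
    filter_upwards [hev] with k hk
    have h2 := one_sub_pow_succ_ne_zero hq k
    have : qBinCoeff a b q (k + 1) * x ^ (k + 1) =
        ((b - a * q ^ k) / (1 - q ^ (k + 1)) * x) * (qBinCoeff a b q k * x ^ k) := by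
      have := qBinCoeff_succ hq a b k
      field_simp
      linear_combination (x ^ k * x) * this
    rw [this, norm_mul, Real.norm_of_nonneg (by positivity), norm_norm]
    gcongr
  exact hs

/-- Comparing coefficients of x^(k+1) reduces this to `qBinCoeff_succ`. The quotient
(ax;q)_∞/(bx;q)_∞ obeys the same equation. -/
theorem qBinCoeff_tsum_functional {a b q x : ℂ} (hq : ‖q‖ < 1) (hx : ‖b * x‖ < 1) :
    (1 - b * x) * ∑' k, qBinCoeff a b q k * x ^ k =
      (1 - a * x) * ∑' k, qBinCoeff a b q k * (q * x) ^ k := by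
  have hqx : ‖b * (q * x)‖ < 1 := by
    rw [show b * (q * x) = b * x * q ^ 1 by ring]
    exact norm_mul_pow_lt_one hq hx 1
  have h1 := (summable_norm_qBinCoeff (a := a) hq hx).of_norm
  have h2 := (summable_norm_qBinCoeff (a := a) hq hqx).of_norm
  have e1 := h1.tsum_eq_zero_add
  have e2 := h2.tsum_eq_zero_add
  have s1 := (summable_nat_add_iff 1).mpr h1
  have s2 := (summable_nat_add_iff 1).mpr h2
  have key : ∑' k, qBinCoeff a b q (k + 1) * x ^ (k + 1) -
      ∑' k, qBinCoeff a b q (k + 1) * (q * x) ^ (k + 1) =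
      b * x * (∑' k, qBinCoeff a b q k * x ^ k) -
        a * x * ∑' k, qBinCoeff a b q k * (q * x) ^ k := by
    rw [← s1.tsum_sub s2, ← tsum_mul_left, ← tsum_mul_left,
      ← (h1.mul_left _).tsum_sub (h2.mul_left _)]
    refine tsum_congr fun k => ?_
    have := qBinCoeff_succ hq a b k
    rw [mul_pow, mul_pow]
    linear_combination x ^ (k + 1) * this
  simp only [pow_zero, mul_one] at e1 e2
  linear_combination e1 - e2 + key

/-- The `q`-binomial theorem. -/
theorem hasSum_qBinCoeff {a b q x : ℂ} (hq : ‖q‖ < 1) (hx : ‖b * x‖ < 1) :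
    HasSum (fun k => qBinCoeff a b q k * x ^ k) (qPochInf (a * x) q / qPochInf (b * x) q) := by
  have hs := summable_norm_qBinCoeff (a := a) hq hx
  -- Iterating pushes the argument to q^N x → 0, where only the constant term 1 of the series
  -- survives.
  have hiter : ∀ N : ℕ, qPoch (b * x) q N * ∑' k, qBinCoeff a b q k * x ^ k =
      qPoch (a * x) q N * ∑' k, qBinCoeff a b q k * (q ^ N * x) ^ k := by
    intro N
    induction N with
    | zero => simp [qPoch]
    | succ N ih =>
      have hN : ‖b * (q ^ N * x)‖ < 1 := by
        rw [show b * (q ^ N * x) = b * x * q ^ N by ring]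
        exact norm_mul_pow_lt_one hq hx N
      have := qBinCoeff_tsum_functional (a := a) hq hN
      rw [← mul_assoc q, ← pow_succ'] at this
      rw [qPoch_succ, qPoch_succ]
      linear_combination (1 - b * x * q ^ N) * ih + qPoch (a * x) q N * this
  have hlim : Tendsto (fun N : ℕ => ∑' k, qBinCoeff a b q k * (q ^ N * x) ^ k) atTop (𝓝 1) := by
    have h1 : ∑' k : ℕ, (if k = 0 then (1 : ℂ) else 0) = 1 := by simp
    rw [← h1]
    refine tendsto_tsum_of_dominated_convergence hs (fun k => ?_) (.of_forall fun N k => ?_)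
    · rcases Nat.eq_zero_or_pos k with rfl | hk
      · simp [qBinCoeff_zero]
      · have hqk : Tendsto (fun N : ℕ => q ^ N) atTop (𝓝 0) :=
          tendsto_pow_atTop_nhds_zero_of_norm_lt_one hq
        simpa [hk.ne'] using ((hqk.mul_const x).pow k).const_mul (qBinCoeff a b q k)
    · rw [mul_pow, norm_mul, norm_mul, norm_mul, norm_pow (q ^ N), norm_pow q]
      gcongr
      exact mul_le_of_le_one_left (norm_nonneg _)
        (pow_le_one₀ (by positivity) (pow_le_one₀ (norm_nonneg _) hq.le))
  have hE := tendsto_nhds_unique ((tendsto_qPoch hq (b * x)).mul_const _)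
    ((((tendsto_qPoch hq (a * x)).mul hlim)).congr fun N => (hiter N).symm)
  rw [mul_one] at hE
  rw [← hE, mul_div_cancel_left₀ _ (qPochInf_ne_zero hq hx)]
  exact hs.of_norm.hasSum

/-! ### Expansion and recurrence of C_n -/

/-- The generating function expands into the Cauchy product of two `q`-binomial series. -/
theorem hasSum_genFun {α β q z t : ℂ} (hq : ‖q‖ < 1) (hz : ‖z‖ = 1) (ht : ‖t‖ < 1) :
    HasSum (fun n => (∑ p ∈ Finset.HasAntidiagonal.antidiagonal n,
      qBinCoeff α 1 q p.1 * z ^ p.1 * (qBinCoeff β 1 q p.2 * z⁻¹ ^ p.2)) * t ^ n)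
      (genFun α β q z t) := by
  have h1 : ‖1 * (t * z)‖ < 1 := by simpa [hz] using ht
  have h2 : ‖1 * (t * z⁻¹)‖ < 1 := by simpa [hz] using ht
  have s1 := summable_norm_qBinCoeff (a := α) hq h1
  have s2 := summable_norm_qBinCoeff (a := β) hq h2
  have e1 := (hasSum_qBinCoeff (a := α) hq h1).tsum_eq
  have e2 := (hasSum_qBinCoeff (a := β) hq h2).tsum_eq
  have hS := (summable_norm_sum_mul_antidiagonal_of_summable_norm s1 s2).of_norm.hasSum
  rw [← tsum_mul_tsum_eq_tsum_sum_antidiagonal_of_summable_norm s1 s2, e1, e2] at hS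
  have hg : genFun α β q z t = qPochInf (α * (t * z)) q / qPochInf (1 * (t * z)) q *
      (qPochInf (β * (t * z⁻¹)) q / qPochInf (1 * (t * z⁻¹)) q) := by
    simp only [genFun, one_mul, ← mul_assoc]
    rw [mul_div_mul_comm]
  rw [hg]
  refine hS.congr_fun fun n => ?_
  rw [Finset.sum_mul]
  refine Finset.sum_congr rfl fun p hp => ?_
  rw [← Finset.HasAntidiagonal.mem_antidiagonal.mp hp, mul_pow, mul_pow, pow_add]
  ring

theorem C_eq_sum {α β q z : ℂ} (hq : ‖q‖ < 1) (hz : ‖z‖ = 1) (n : ℕ) :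
    C α β q n z = ∑ p ∈ Finset.HasAntidiagonal.antidiagonal n,
      qBinCoeff α 1 q p.1 * z ^ p.1 * (qBinCoeff β 1 q p.2 * z⁻¹ ^ p.2) := by
  have hp : HasFPowerSeriesAt (genFun α β q z) (FormalMultilinearSeries.ofScalars ℂ
      fun n => ∑ p ∈ Finset.HasAntidiagonal.antidiagonal n,
        qBinCoeff α 1 q p.1 * z ^ p.1 * (qBinCoeff β 1 q p.2 * z⁻¹ ^ p.2)) 0 := by
    rw [hasFPowerSeriesAt_iff]
    filter_upwards [Metric.ball_mem_nhds (0 : ℂ) one_pos] with t ht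
    simpa [mul_comm] using hasSum_genFun (α := α) (β := β) hq hz (by simpa using ht)
  have := hp.analyticAt.hasFPowerSeriesAt.eq_formalMultilinearSeries hp
  have h := congrArg (fun p => FormalMultilinearSeries.coeff p n) this
  simpa [C] using h

theorem hasSum_C {α β q z t : ℂ} (hq : ‖q‖ < 1) (hz : ‖z‖ = 1) (ht : ‖t‖ < 1) :
    HasSum (fun n => C α β q n z * t ^ n) (genFun α β q z t) := by
  simpa only [C_eq_sum hq hz] using hasSum_genFun hq hz ht

theorem C_zero {α β q z : ℂ} (hq : ‖q‖ < 1) (hz : ‖z‖ = 1) : C α β q 0 z = 1 := by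
  simp [C_eq_sum hq hz, qBinCoeff_zero]

open PowerSeries in
theorem mk_qBinCoeff_functional {q : ℂ} (hq : ‖q‖ < 1) (a y : ℂ) :
    (1 - PowerSeries.C y * X) * mk (fun k => qBinCoeff a 1 q k * y ^ k) =
      (1 - PowerSeries.C (a * y) * X) * rescale q (mk fun k => qBinCoeff a 1 q k * y ^ k) := by
  ext n
  cases n with
  | zero =>
    simp only [sub_mul, one_mul, map_sub, mul_assoc, coeff_C_mul, coeff_zero_X_mul, coeff_mk,
      coeff_rescale, pow_zero, mul_zero]
  | succ n =>
    simp only [sub_mul, one_mul, map_sub, mul_assoc, coeff_C_mul, coeff_succ_X_mul, coeff_mk,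
      coeff_rescale]
    linear_combination y ^ (n + 1) * qBinCoeff_succ hq a 1 n

open PowerSeries in
-- The product of the functional equations of the two q-binomial factors, with parameters z and z⁻¹;
-- z z⁻¹ = 1 simplifies the quadratic terms. Its coefficients give the recurrence of C_n.
theorem mk_C_functional {α β q z : ℂ} (hq : ‖q‖ < 1) (hz : ‖z‖ = 1) :
    (1 - PowerSeries.C (z + z⁻¹) * X + X * X) * mk (fun n => QOrth.C α β q n z) =
      (1 - PowerSeries.C (α * z + β * z⁻¹) * X + PowerSeries.C (α * β) * (X * X)) *
        rescale q (mk fun n => QOrth.C α β q n z) := by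
  have hz0 : z ≠ 0 := by rintro rfl; simp at hz
  have hmk : mk (fun n => QOrth.C α β q n z) = mk (fun k => qBinCoeff α 1 q k * z ^ k) *
      mk (fun k => qBinCoeff β 1 q k * z⁻¹ ^ k) := by
    ext n
    simp [coeff_mul, C_eq_sum hq hz]
  have h1 := mk_qBinCoeff_functional hq α z
  have h2 := mk_qBinCoeff_functional hq β z⁻¹
  have hc : (PowerSeries.C z * PowerSeries.C z⁻¹ : ℂ⟦X⟧) = 1 := by
    rw [← map_mul, mul_inv_cancel₀ hz0, map_one]
  rw [hmk, map_mul]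
  set U := mk (fun k => qBinCoeff α 1 q k * z ^ k)
  set V := mk (fun k => qBinCoeff β 1 q k * z⁻¹ ^ k)
  have h3 := congrArg₂ (fun S T : ℂ⟦X⟧ => S * T) h1 h2
  simp only [map_mul, map_add] at h3 ⊢
  linear_combination h3 +
    (X * X * PowerSeries.C α * PowerSeries.C β * rescale q U * rescale q V - X * X * U * V) * hc

theorem C_one {α β q z : ℂ} (hq : ‖q‖ < 1) (hz : ‖z‖ = 1) :
    (1 - q) * C α β q 1 z = (1 - α) * z + (1 - β) * z⁻¹ := by
  have h := congrArg (PowerSeries.coeff (0 + 1)) (mk_C_functional (α := α) (β := β) hq hz)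
  simp only [sub_mul, add_mul, one_mul, map_sub, map_add, mul_assoc, PowerSeries.coeff_C_mul,
    PowerSeries.coeff_succ_X_mul, PowerSeries.coeff_zero_X_mul, PowerSeries.coeff_mk,
    PowerSeries.coeff_rescale, C_zero hq hz, zero_add, pow_zero, pow_one] at h
  linear_combination h

/-- The three-term recurrence of the functions `C_n`. -/
theorem C_add_two {α β q z : ℂ} (hq : ‖q‖ < 1) (hz : ‖z‖ = 1) (n : ℕ) :
    (1 - q ^ (n + 2)) * C α β q (n + 2) z =
      ((1 - α * q ^ (n + 1)) * z + (1 - β * q ^ (n + 1)) * z⁻¹) * C α β q (n + 1) z -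
        (1 - α * β * q ^ n) * C α β q n z := by
  have h := congrArg (PowerSeries.coeff (n + 1 + 1)) (mk_C_functional (α := α) (β := β) hq hz)
  simp only [sub_mul, add_mul, one_mul, map_sub, map_add, mul_assoc, PowerSeries.coeff_C_mul,
    PowerSeries.coeff_succ_X_mul, PowerSeries.coeff_mk, PowerSeries.coeff_rescale] at h
  linear_combination h

theorem qBinCoeff_one (a q : ℂ) (n : ℕ) : qBinCoeff a 1 q n = qPoch a q n / qPoch q q n := rfl

/-! ### Fourier integrals on the unit circle -/

/-- The point `e^{iθ}` of the unit circle. -/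
noncomputable def expI (θ : ℝ) : ℂ := Complex.exp (Complex.I * θ)

theorem norm_expI (θ : ℝ) : ‖expI θ‖ = 1 := by
  rw [expI, mul_comm, Complex.norm_exp_ofReal_mul_I]

theorem expI_ne_zero (θ : ℝ) : expI θ ≠ 0 := Complex.exp_ne_zero _

theorem continuous_expI : Continuous expI := by unfold expI; fun_prop

theorem expI_neg (θ : ℝ) : expI (-θ) = (expI θ)⁻¹ := by
  simp [expI, ← Complex.exp_neg]

theorem expI_add_pi (θ : ℝ) : expI (θ + Real.pi) = -expI θ := by
  simp only [expI]
  push_cast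
  rw [mul_add, Complex.exp_add, mul_comm Complex.I (Real.pi : ℂ), Complex.exp_pi_mul_I]
  ring

theorem periodic_expI : Function.Periodic expI (2 * Real.pi) := by
  intro θ
  rw [two_mul, ← add_assoc, expI_add_pi, expI_add_pi, neg_neg]

theorem continuous_expI_zpow (j : ℤ) : Continuous fun θ => expI θ ^ j :=
  continuous_expI.zpow₀ j fun θ => .inl (expI_ne_zero θ)

theorem integral_expI_zpow (j : ℤ) :
    ∫ θ in (0 : ℝ)..(2 * Real.pi), expI θ ^ j = if j = 0 then 2 * (Real.pi : ℂ) else 0 := by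
  split_ifs with hj
  · simp [hj]
  · have hc : (j : ℂ) * Complex.I ≠ 0 := by simp [hj]
    have : ∀ θ : ℝ, expI θ ^ j = Complex.exp ((j : ℂ) * Complex.I * θ) := fun θ => by
      rw [expI, ← Complex.exp_int_mul, mul_assoc]
    simp_rw [this]
    rw [integral_exp_mul_complex hc]
    have h2 : Complex.exp ((j : ℂ) * Complex.I * ((2 * Real.pi : ℝ) : ℂ)) = 1 := by
      rw [Complex.exp_eq_one_iff]
      exact ⟨j, by push_cast; ring⟩
    rw [h2]
    simp

theorem hasSum_integral_tsum_mul {c : ℕ → ℂ} {u : ℕ → ℝ → ℂ} {g : ℝ → ℂ}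
    (hc : Summable fun k => ‖c k‖) (hu : ∀ k, Continuous (u k)) (hu1 : ∀ k θ, ‖u k θ‖ = 1)
    (hg : Continuous g) :
    HasSum (fun k => c k * ∫ θ in (0 : ℝ)..(2 * Real.pi), u k θ * g θ)
      (∫ θ in (0 : ℝ)..(2 * Real.pi), (∑' k, c k * u k θ) * g θ) := by
  have := intervalIntegral.hasSum_integral_of_dominated_convergence
    (μ := volume) (a := 0) (b := 2 * Real.pi)
    (F := fun k θ => c k * (u k θ * g θ)) (f := fun θ => (∑' k, c k * u k θ) * g θ)
    (fun k θ => ‖c k‖ * ‖g θ‖)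
    (fun k => (continuous_const.mul ((hu k).mul hg)).aestronglyMeasurable)
    (fun k => .of_forall fun θ _ => by simp [hu1])
    (.of_forall fun θ _ => hc.mul_right _)
    (by
      simp_rw [tsum_mul_right]
      exact (continuous_const.mul hg.norm).intervalIntegrable _ _)
    (.of_forall fun θ _ => by
      have hs : Summable fun k => c k * u k θ := .of_norm (by simpa [hu1] using hc)
      simpa [mul_assoc] using hs.hasSum.mul_right (g θ))
  simpa only [intervalIntegral.integral_const_mul] using this

theorem continuous_tsum_mul {c : ℕ → ℂ} {u : ℕ → ℝ → ℂ}
    (hc : Summable fun k => ‖c k‖) (hu : ∀ k, Continuous (u k)) (hu1 : ∀ k θ, ‖u k θ‖ = 1) :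
    Continuous fun θ => ∑' k, c k * u k θ :=
  continuous_tsum (fun k => continuous_const.mul (hu k)) hc fun k θ => by simp [hu1]

/-! ### The kernel ψ and its Fourier series -/

/-- The quotient `(x, q/x; q)_∞ / (α x, β/x; q)_∞` of Ramanujan's bilateral summation. -/
noncomputable def psiKernel (α β q x : ℂ) : ℂ :=
  qPochInf x q * qPochInf (x⁻¹ * q) q / (qPochInf (α * x) q * qPochInf (β * x⁻¹) q)

theorem weight_eq {q : ℂ} (hq : ‖q‖ < 1) (α β : ℂ) (θ : ℝ) :
    weight α β q θ = (1 - (expI θ ^ 2)⁻¹) * psiKernel α β q (expI θ ^ 2) := by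
  have h1 : Complex.exp (2 * Complex.I * θ) = expI θ ^ 2 := by
    rw [expI, ← Complex.exp_nat_mul]; push_cast; ring_nf
  have h2 : Complex.exp (-2 * Complex.I * θ) = (expI θ ^ 2)⁻¹ := by
    rw [← h1, ← Complex.exp_neg]; ring_nf
  rw [weight, h1, h2, psiKernel, qPochInf_eq_one_sub_mul hq (expI θ ^ 2)⁻¹]
  ring

/-- Peeling the first factor off (x;q)_∞ and off (x⁻¹;q)_∞ leaves the ratio (1 - x⁻¹)/(1 - x) =
-x⁻¹. -/
theorem psiKernel_inv {q x : ℂ} (hq : ‖q‖ < 1) (hx : x ≠ 0) (α β : ℂ) :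
    psiKernel α β q x⁻¹ = -x⁻¹ * psiKernel β α q x := by
  rw [psiKernel, psiKernel, qPochInf_eq_one_sub_mul hq x, qPochInf_eq_one_sub_mul hq x⁻¹, inv_inv,
    mul_comm (qPochInf (β * x) q), mul_div_assoc', mul_comm (qPochInf (α * x⁻¹) q)]
  congr 1
  field_simp
  ring

theorem summable_norm_qBinCoeff_of_norm_lt {q b : ℂ} (hq : ‖q‖ < 1) (hb : ‖b‖ < 1) (a : ℂ) :
    Summable fun k => ‖qBinCoeff a b q k‖ := by
  simpa using summable_norm_qBinCoeff (a := a) (x := 1) hq (by simpa using hb)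

theorem psiKernel_eq_tsum {α β q x : ℂ} (hq : ‖q‖ < 1) (hα : ‖α‖ < 1) (hβ : ‖β‖ < 1)
    (hx : ‖x‖ = 1) :
    psiKernel α β q x =
      (∑' k, qBinCoeff 1 α q k * x ^ k) * ∑' k, qBinCoeff q β q k * x⁻¹ ^ k := by
  rw [(hasSum_qBinCoeff (a := 1) (b := α) (x := x) hq (by simpa [hx] using hα)).tsum_eq,
    (hasSum_qBinCoeff (a := q) (b := β) (x := x⁻¹) hq (by simpa [hx] using hβ)).tsum_eq,
    psiKernel, one_mul, mul_comm q, mul_div_mul_comm]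

theorem continuous_psiKernel {α β q : ℂ} (hq : ‖q‖ < 1) (hα : ‖α‖ < 1) (hβ : ‖β‖ < 1) :
    Continuous fun θ => psiKernel α β q (expI θ ^ 2) := by
  have hx : ∀ θ, ‖expI θ ^ 2‖ = 1 := by simp [norm_expI]
  simp_rw [psiKernel_eq_tsum hq hα hβ (hx _)]
  refine (continuous_tsum_mul (summable_norm_qBinCoeff_of_norm_lt hq hα 1) (fun k => ?_) ?_).mul
    (continuous_tsum_mul (summable_norm_qBinCoeff_of_norm_lt hq hβ q) (fun k => ?_) ?_)
  · exact (continuous_expI.pow 2).pow k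
  · simp [norm_expI]
  · exact ((continuous_expI.pow 2).inv₀ fun θ => pow_ne_zero _ (expI_ne_zero θ)).pow k
  · simp [norm_expI]

theorem integral_expI_zpow_mul_tsum {c : ℕ → ℂ} (hc : Summable fun k => ‖c k‖) (m : ℕ) :
    ∫ θ in (0 : ℝ)..(2 * Real.pi), (∑' k, c k * (expI θ ^ 2)⁻¹ ^ k) * expI θ ^ (2 * m : ℤ) =
      2 * Real.pi * c m := by
  have h := hasSum_integral_tsum_mul (u := fun k θ => (expI θ ^ 2)⁻¹ ^ k) hc
    (fun k => ((continuous_expI.pow 2).inv₀ fun θ => pow_ne_zero _ (expI_ne_zero θ)).pow k)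
    (fun k θ => by simp [norm_expI]) (continuous_expI_zpow (2 * m))
  have hk : ∀ k : ℕ, ∫ θ in (0 : ℝ)..(2 * Real.pi),
      (expI θ ^ 2)⁻¹ ^ k * expI θ ^ (2 * m : ℤ) = if k = m then 2 * (Real.pi : ℂ) else 0 := by
    intro k
    have : ∀ θ, (expI θ ^ 2)⁻¹ ^ k * expI θ ^ (2 * m : ℤ) = expI θ ^ (2 * m - 2 * k : ℤ) := by
      intro θ
      rw [zpow_sub₀ (expI_ne_zero θ), inv_pow, ← pow_mul, div_eq_inv_mul]
      norm_cast
    simp_rw [this, integral_expI_zpow]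
    congr 1
    simp only [eq_iff_iff]
    omega
  rw [← h.tsum_eq]
  simp_rw [hk]
  rw [tsum_eq_single m (by intro k hk; simp [hk])]
  simp [mul_comm]

/-- The Fourier coefficients of `psiKernel` of nonpositive index, as series. -/
theorem integral_psiKernel_eq_tsum {α β q : ℂ} (hq : ‖q‖ < 1) (hα : ‖α‖ < 1) (hβ : ‖β‖ < 1)
    (i : ℕ) :
    ∫ θ in (0 : ℝ)..(2 * Real.pi), psiKernel α β q (expI θ ^ 2) * expI θ ^ (2 * i : ℤ) =
      2 * Real.pi * ∑' k, qBinCoeff 1 α q k * qBinCoeff q β q (k + i) := by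
  have hx : ∀ θ, ‖expI θ ^ 2‖ = 1 := by simp [norm_expI]
  have hb := summable_norm_qBinCoeff_of_norm_lt hq hβ q
  have hB : Continuous fun θ => (∑' k, qBinCoeff q β q k * (expI θ ^ 2)⁻¹ ^ k) :=
    continuous_tsum_mul hb
      (fun k => ((continuous_expI.pow 2).inv₀ fun θ => pow_ne_zero _ (expI_ne_zero θ)).pow k)
      (by simp [norm_expI])
  have h := hasSum_integral_tsum_mul (u := fun k θ => (expI θ ^ 2) ^ k)
    (summable_norm_qBinCoeff_of_norm_lt hq hα 1) (fun k => (continuous_expI.pow 2).pow k)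
    (fun k θ => by simp [norm_expI]) (hB.mul (continuous_expI_zpow (2 * i)))
  have hk : ∀ k : ℕ, ∫ θ in (0 : ℝ)..(2 * Real.pi), (expI θ ^ 2) ^ k *
      ((∑' k, qBinCoeff q β q k * (expI θ ^ 2)⁻¹ ^ k) * expI θ ^ (2 * i : ℤ)) =
      2 * Real.pi * qBinCoeff q β q (k + i) := by
    intro k
    rw [← integral_expI_zpow_mul_tsum hb]
    congr 1
    ext θ
    have : expI θ ^ (2 * ((k + i : ℕ) : ℤ)) = (expI θ ^ 2) ^ k * expI θ ^ (2 * i : ℤ) := by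
      norm_cast
      rw [← pow_mul, ← pow_add, mul_add]
    rw [this]
    ring
  rw [← tsum_mul_left]
  simp_rw [psiKernel_eq_tsum hq hα hβ (hx _), mul_assoc (∑' k, qBinCoeff 1 α q k * _)]
  simp only [Pi.mul_apply] at h
  exact h.tsum_eq.symm.trans (tsum_congr fun k =>
    (congrArg (qBinCoeff 1 α q k * ·) (hk k)).trans (by ring))

/-! ### A q-Gauss sum -/

/-- The series `∑ₖ a_k b_{k+i}` of `integral_psiKernel_eq_tsum`, divided by
`∏_{l < i} (β - q^{l+1})`. -/
noncomputable def gaussSeries (α β q : ℂ) (i : ℕ) : ℂ :=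
  ∑' k, qBinCoeff 1 α q k *
    ((∏ l ∈ Finset.range k, (β - q ^ (l + i + 1))) / qPoch q q (k + i))

theorem exists_norm_inv_qPoch_le {q : ℂ} (hq : ‖q‖ < 1) :
    ∃ K, ∀ n, ‖(qPoch q q n)⁻¹‖ ≤ K := by
  have h := ((tendsto_qPoch hq q).inv₀ (qPochInf_ne_zero hq hq)).norm.bddAbove_range
  obtain ⟨K, hK⟩ := h
  exact ⟨K, fun n => hK ⟨n, rfl⟩⟩

/-- Each factor is at most |β| + |q|^i, which is eventually at most 1. Uniformity in k supplies the
domination for i → ∞. -/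
theorem eventually_norm_prod_le_one {q β : ℂ} (hq : ‖q‖ < 1) (hβ : ‖β‖ < 1) :
    ∀ᶠ i : ℕ in atTop, ∀ k, ‖∏ l ∈ Finset.range k, (β - q ^ (l + i + 1))‖ ≤ 1 := by
  have h : Tendsto (fun i : ℕ => ‖β‖ + ‖q‖ ^ i) atTop (𝓝 (‖β‖ + 0)) :=
    (tendsto_pow_atTop_nhds_zero_of_lt_one (norm_nonneg _) hq).const_add _
  filter_upwards [h.eventually_le_const (u := 1) (by simpa using hβ)] with i hi k
  rw [norm_prod]
  refine Finset.prod_le_one (fun _ _ => norm_nonneg _) fun l _ => ?_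
  refine (norm_sub_le _ _).trans (le_trans ?_ hi)
  rw [norm_pow]
  exact add_le_add_right (pow_le_pow_of_le_one (norm_nonneg _) hq.le (by omega)) _

/-- All but the first N factors form a product with shifted index, bounded by the previous lemma;
those N factors are at most 2 each. -/
theorem norm_prod_sub_le {q β : ℂ} (hq : ‖q‖ < 1) (hβ : ‖β‖ < 1) (i : ℕ) :
    ∃ K, ∀ k, ‖∏ l ∈ Finset.range k, (β - q ^ (l + i + 1))‖ ≤ K := by
  obtain ⟨N, hN⟩ := (eventually_norm_prod_le_one hq hβ).exists_forall_of_atTop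
  refine ⟨2 ^ N, fun k => ?_⟩
  have hfac : ∀ l, ‖β - q ^ (l + i + 1)‖ ≤ 2 := fun l => by
    refine (norm_sub_le _ _).trans ?_
    rw [norm_pow]
    have := pow_le_one₀ (n := l + i + 1) (norm_nonneg q) hq.le
    linarith
  have hpre : ∀ m, ‖∏ l ∈ Finset.range m, (β - q ^ (l + i + 1))‖ ≤ 2 ^ m := fun m => by
    rw [norm_prod]
    simpa using Finset.prod_le_prod (s := Finset.range m) (fun l _ => norm_nonneg _)
      fun l _ => hfac l
  rcases le_total k N with h | h
  · exact (hpre k).trans (pow_le_pow_right₀ one_le_two h)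
  · obtain ⟨m, rfl⟩ := Nat.exists_eq_add_of_le h
    rw [Finset.prod_range_add, norm_mul]
    have h2 := hN (N + i) (by omega) m
    rw [show (∏ x ∈ Finset.range m, (β - q ^ (N + x + i + 1))) =
      ∏ l ∈ Finset.range m, (β - q ^ (l + (N + i) + 1)) from
        Finset.prod_congr rfl fun l _ => by ring_nf]
    calc _ ≤ (2 : ℝ) ^ N * 1 := by gcongr; exact hpre N
      _ = 2 ^ N := mul_one _

theorem summable_gaussSeries {α β q : ℂ} (hq : ‖q‖ < 1) (hα : ‖α‖ < 1) (hβ : ‖β‖ < 1) (i : ℕ) :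
    Summable fun k => qBinCoeff 1 α q k *
      ((∏ l ∈ Finset.range k, (β - q ^ (l + i + 1))) / qPoch q q (k + i)) := by
  obtain ⟨K, hK⟩ := exists_norm_inv_qPoch_le hq
  obtain ⟨K', hK'⟩ := norm_prod_sub_le hq hβ i
  refine Summable.of_norm_bounded
    ((summable_norm_qBinCoeff_of_norm_lt hq hα 1).mul_right (K' * K)) fun k => ?_
  rw [norm_mul, div_eq_mul_inv, norm_mul]
  have := (norm_nonneg _).trans (hK' 0)
  gcongr
  · exact hK' k
  · exact hK _

/-- The contiguous relation behind the `q`-Gauss sum. -/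
theorem gaussSeries_succ {α β q : ℂ} (hq : ‖q‖ < 1) (hα : ‖α‖ < 1) (hβ : ‖β‖ < 1) (i : ℕ) :
    gaussSeries α β q i = (1 - α * q ^ (i + 1)) * gaussSeries α β q (i + 1) := by
  have s0 := summable_gaussSeries hq hα hβ i
  have s1 := summable_gaussSeries hq hα hβ (i + 1)
  set t : ℕ → ℂ := fun k => qBinCoeff 1 α q k *
    ((∏ l ∈ Finset.range k, (β - q ^ (l + i + 1))) / qPoch q q (k + i)) with ht
  set t' : ℕ → ℂ := fun k => qBinCoeff 1 α q k *
    ((∏ l ∈ Finset.range k, (β - q ^ (l + (i + 1) + 1))) / qPoch q q (k + (i + 1))) with ht'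
  -- The difference of the two series telescopes: its partial sums have this closed form, which
  -- tends to 0 with `t' n`.
  have hsum : ∀ n, ∑ k ∈ Finset.range (n + 1), (t k - (1 - α * q ^ (i + 1)) * t' k) =
      q ^ (i + 1) * (α - q ^ n) * t' n := by
    intro n
    induction n with
    | zero =>
      have h1 := qPoch_ne_zero hq hq i
      have h2 := one_sub_pow_succ_ne_zero hq i
      simp only [zero_add, Finset.sum_range_one, ht, ht', qBinCoeff_zero, Finset.prod_range_zero,
        qPoch_succ, ← pow_succ', pow_zero]
      field_simp
      ring
    | succ n ih =>
      have hp : ∏ l ∈ Finset.range (n + 1), (β - q ^ (l + i + 1)) =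
          (∏ l ∈ Finset.range n, (β - q ^ (l + (i + 1) + 1))) * (β - q ^ (i + 1)) := by
        rw [Finset.prod_range_succ', zero_add]
        congr 1
        exact Finset.prod_congr rfl fun l _ => by ring_nf
      have h1 := qPoch_ne_zero hq hq (n + (i + 1))
      have h2 := one_sub_pow_succ_ne_zero hq (n + (i + 1))
      have h3 := qBinCoeff_succ hq 1 α n
      rw [Finset.sum_range_succ, ih]
      simp only [ht, ht']
      rw [hp, show n + 1 + i = n + (i + 1) by ring, show n + 1 + (i + 1) = n + (i + 1) + 1 by ring,
        qPoch_succ, ← pow_succ', Finset.prod_range_succ]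
      set p := ∏ l ∈ Finset.range n, (β - q ^ (l + (i + 1) + 1))
      set P := qPoch q q (n + (i + 1))
      have h4 : q ^ (i + 1) * (α - q ^ n) * (qBinCoeff 1 α q n * (p / P)) =
          q ^ (i + 1) * (p / P) * (qBinCoeff 1 α q (n + 1) * (1 - q ^ (n + 1))) := by
        rw [h3]; ring
      rw [h4]
      field_simp
      ring
  have hlim : Tendsto (fun n => ∑ k ∈ Finset.range (n + 1), (t k - (1 - α * q ^ (i + 1)) * t' k))
      atTop (𝓝 0) := by
    simp_rw [hsum]
    have := (((tendsto_pow_atTop_nhds_zero_of_norm_lt_one hq).const_sub α).const_mul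
      (q ^ (i + 1))).mul s1.tendsto_atTop_zero
    simpa using this
  have hd := (s0.sub (s1.mul_left (1 - α * q ^ (i + 1)))).hasSum.tendsto_sum_nat.comp
    (tendsto_add_atTop_nat 1)
  have h0 := tendsto_nhds_unique hd hlim
  rw [s0.tsum_sub (s1.mul_left _), tsum_mul_left] at h0
  exact sub_eq_zero.mp h0

/-- Termwise, the product tends to β^k and the denominator to (q;q)_∞; the limiting series is summed
by the q-binomial theorem at x = β. -/
theorem tendsto_gaussSeries {α β q : ℂ} (hq : ‖q‖ < 1) (hα : ‖α‖ < 1) (hβ : ‖β‖ < 1) :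
    Tendsto (gaussSeries α β q) atTop
      (𝓝 (qPochInf β q / (qPochInf (α * β) q * qPochInf q q))) := by
  obtain ⟨K, hK⟩ := exists_norm_inv_qPoch_le hq
  have hαβ : ‖α * β‖ < 1 := by
    rw [norm_mul]
    exact (mul_le_of_le_one_right (norm_nonneg _) hβ.le).trans_lt hα
  have hlim : qPochInf β q / (qPochInf (α * β) q * qPochInf q q) =
      ∑' k, qBinCoeff 1 α q k * (β ^ k / qPochInf q q) := by
    simp_rw [← mul_div_assoc]
    rw [tsum_div_const, (hasSum_qBinCoeff (a := 1) hq hαβ).tsum_eq, one_mul, div_div]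
  rw [hlim]
  refine tendsto_tsum_of_dominated_convergence
    ((summable_norm_qBinCoeff_of_norm_lt hq hα 1).mul_right K) (fun k => ?_) ?_
  · refine Tendsto.const_mul _ (Tendsto.div ?_ ?_ (qPochInf_ne_zero hq hq))
    · have : β ^ k = ∏ l ∈ Finset.range k, (β - 0) := by simp
      rw [this]
      refine tendsto_finsetProd _ fun l _ => ?_
      refine ((tendsto_pow_atTop_nhds_zero_of_norm_lt_one hq).comp ?_).const_sub β
      exact tendsto_atTop_mono (fun i => by simp only [id]; omega) tendsto_id
    · exact (tendsto_qPoch hq q).comp (tendsto_atTop_mono (fun i => by simp) tendsto_id)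
  · filter_upwards [eventually_norm_prod_le_one hq hβ] with i hi k
    rw [norm_mul, div_eq_mul_inv, norm_mul]
    gcongr
    calc _ ≤ 1 * K := mul_le_mul (hi k) (hK _) (norm_nonneg _) zero_le_one
      _ = K := one_mul K

/-- A form of the `q`-Gauss sum. -/
theorem gaussSeries_eq {α β q : ℂ} (hq : ‖q‖ < 1) (hα : ‖α‖ < 1) (hβ : ‖β‖ < 1) (i : ℕ) :
    gaussSeries α β q i = qPochInf (α * q ^ (i + 1)) q *
      (qPochInf β q / (qPochInf (α * β) q * qPochInf q q)) := by
  have h : ∀ n, gaussSeries α β q i =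
      qPoch (α * q ^ (i + 1)) q n * gaussSeries α β q (n + i) := by
    intro n
    induction n with
    | zero => simp [qPoch]
    | succ n ih =>
      rw [ih, gaussSeries_succ hq hα hβ, qPoch_succ, show n + 1 + i = n + i + 1 by ring]
      ring
  exact tendsto_nhds_unique (tendsto_const_nhds.congr h)
    ((tendsto_qPoch hq _).mul ((tendsto_gaussSeries hq hα hβ).comp (tendsto_add_atTop_nat i)))

/-- The Fourier coefficients of `psiKernel` of nonpositive index, in closed form. -/
theorem integral_psiKernel {α β q : ℂ} (hq : ‖q‖ < 1) (hα : ‖α‖ < 1) (hβ : ‖β‖ < 1) (i : ℕ) :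
    ∫ θ in (0 : ℝ)..(2 * Real.pi), psiKernel α β q (expI θ ^ 2) * expI θ ^ (2 * i : ℤ) =
      2 * Real.pi * (qPochInf β q / (qPochInf (α * β) q * qPochInf q q)) *
        ((∏ l ∈ Finset.range i, (β - q ^ (l + 1))) * qPochInf (α * q ^ (i + 1)) q) := by
  rw [integral_psiKernel_eq_tsum hq hα hβ]
  have : ∑' k, qBinCoeff 1 α q k * qBinCoeff q β q (k + i) =
      (∏ l ∈ Finset.range i, (β - q ^ (l + 1))) * gaussSeries α β q i := by
    rw [gaussSeries, ← tsum_mul_left]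
    refine tsum_congr fun k => ?_
    rw [qBinCoeff.eq_1 q, add_comm k i, Finset.prod_range_add]
    simp only [← pow_succ']
    rw [show (∏ x ∈ Finset.range k, (β - q ^ (i + x + 1))) =
      ∏ l ∈ Finset.range k, (β - q ^ (l + i + 1)) from
        Finset.prod_congr rfl fun l _ => by rw [add_comm i l]]
    ring
  rw [this, gaussSeries_eq hq hα hβ]
  ring

/-! ### Moments of C_n -/

theorem continuous_C_expI {q : ℂ} (hq : ‖q‖ < 1) (α β : ℂ) (n : ℕ) :
    Continuous fun θ => C α β q n (expI θ) := by
  simp_rw [C_eq_sum hq (norm_expI _)]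
  refine continuous_finsetSum _ fun p _ => ?_
  exact (continuous_const.mul (continuous_expI.pow _)).mul
    (continuous_const.mul ((continuous_expI.inv₀ expI_ne_zero).pow _))

/-- The moments of `C_n` with respect to `psiKernel`. -/
noncomputable def moment (α β q : ℂ) (n : ℕ) (j : ℤ) : ℂ :=
  ∫ θ in (0 : ℝ)..(2 * Real.pi),
    C α β q n (expI θ) * psiKernel α β q (expI θ ^ 2) * expI θ ^ j

variable {α β q : ℂ}

theorem continuous_moment_integrand (hq : ‖q‖ < 1) (hα : ‖α‖ < 1) (hβ : ‖β‖ < 1)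
    (n : ℕ) (j : ℤ) :
    Continuous fun θ => C α β q n (expI θ) * psiKernel α β q (expI θ ^ 2) * expI θ ^ j :=
  ((continuous_C_expI hq α β n).mul (continuous_psiKernel hq hα hβ)).mul (continuous_expI_zpow j)

theorem moment_zero (hq : ‖q‖ < 1) (j : ℤ) :
    moment α β q 0 j =
      ∫ θ in (0 : ℝ)..(2 * Real.pi), psiKernel α β q (expI θ ^ 2) * expI θ ^ j := by
  simp_rw [moment, C_zero hq (norm_expI _), one_mul]

theorem moment_one (hq : ‖q‖ < 1) (hα : ‖α‖ < 1) (hβ : ‖β‖ < 1) (j : ℤ) :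
    (1 - q) * moment α β q 1 j =
      (1 - α) * moment α β q 0 (j + 1) + (1 - β) * moment α β q 0 (j - 1) := by
  have hi := fun n j => (continuous_moment_integrand hq hα hβ n j).intervalIntegrable
    (μ := volume) 0 (2 * Real.pi)
  simp only [moment]
  rw [← intervalIntegral.integral_const_mul, ← intervalIntegral.integral_const_mul,
    ← intervalIntegral.integral_const_mul,
    ← intervalIntegral.integral_add ((hi _ _).const_mul _) ((hi _ _).const_mul _)]
  congr 1
  ext θ
  have h := C_one (α := α) (β := β) hq (norm_expI θ)
  rw [zpow_add_one₀ (expI_ne_zero θ), zpow_sub_one₀ (expI_ne_zero θ), C_zero hq (norm_expI θ)]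
  linear_combination psiKernel α β q (expI θ ^ 2) * expI θ ^ j * h

theorem moment_add_two (hq : ‖q‖ < 1) (hα : ‖α‖ < 1) (hβ : ‖β‖ < 1) (n : ℕ) (j : ℤ) :
    (1 - q ^ (n + 2)) * moment α β q (n + 2) j =
      (1 - α * q ^ (n + 1)) * moment α β q (n + 1) (j + 1) +
        (1 - β * q ^ (n + 1)) * moment α β q (n + 1) (j - 1) -
        (1 - α * β * q ^ n) * moment α β q n j := by
  have hi := fun n j => (continuous_moment_integrand hq hα hβ n j).intervalIntegrable
    (μ := volume) 0 (2 * Real.pi)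
  simp only [moment]
  rw [← intervalIntegral.integral_const_mul, ← intervalIntegral.integral_const_mul,
    ← intervalIntegral.integral_const_mul, ← intervalIntegral.integral_const_mul,
    ← intervalIntegral.integral_add ((hi _ _).const_mul _) ((hi _ _).const_mul _),
    ← intervalIntegral.integral_sub (((hi _ _).const_mul _).add ((hi _ _).const_mul _))
      ((hi _ _).const_mul _)]
  congr 1
  ext θ
  have h := C_add_two (α := α) (β := β) hq (norm_expI θ) n
  rw [zpow_add_one₀ (expI_ne_zero θ), zpow_sub_one₀ (expI_ne_zero θ)]
  linear_combination psiKernel α β q (expI θ ^ 2) * expI θ ^ j * h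

theorem integral_eq_zero_of_antiperiodic {g : ℝ → ℂ} (hg : ∀ θ, g (θ + Real.pi) = -g θ) :
    ∫ θ in (0 : ℝ)..(2 * Real.pi), g θ = 0 := by
  have hp : Function.Periodic g (2 * Real.pi) := fun θ => by
    rw [two_mul, ← add_assoc, hg, hg, neg_neg]
  have h1 : ∫ θ in (0 : ℝ)..(2 * Real.pi), g (θ + Real.pi) =
      ∫ θ in (0 : ℝ)..(2 * Real.pi), g θ := by
    rw [intervalIntegral.integral_comp_add_right, zero_add]
    have := hp.intervalIntegral_add_eq Real.pi 0
    rwa [zero_add, add_comm Real.pi] at this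
  simp_rw [hg] at h1
  rw [intervalIntegral.integral_neg] at h1
  exact self_eq_neg.mp h1.symm

/-- Parity under θ ↦ θ + π: ψ depends only on z², which settles n = 0, and the recurrence preserves
the parity of n + j. -/
theorem moment_eq_zero_of_odd (hq : ‖q‖ < 1) (hα : ‖α‖ < 1) (hβ : ‖β‖ < 1) (n : ℕ) :
    ∀ j : ℤ, Odd (n + j) → moment α β q n j = 0 := by
  have h0 : ∀ j : ℤ, Odd j → moment α β q 0 j = 0 := fun j hj => by
    rw [moment_zero hq]
    refine integral_eq_zero_of_antiperiodic fun θ => ?_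
    rw [expI_add_pi, neg_sq, hj.neg_zpow, mul_neg]
  induction n using Nat.twoStepInduction with
  | zero => simpa using h0
  | one =>
    intro j hj
    have h := moment_one hq hα hβ j
    rw [h0 (j + 1) (by rw [add_comm]; exact_mod_cast hj), h0 (j - 1) (by
      push_cast at hj; rw [Int.odd_iff] at hj ⊢; omega)] at h
    simpa [one_sub_ne_zero_of_norm_lt_one hq] using h
  | more n ih1 ih2 =>
    intro j hj
    have h := moment_add_two hq hα hβ n j
    push_cast [Int.odd_iff] at hj ih1 ih2
    rw [ih1 j (by omega), ih2 (j + 1) (by omega), ih2 (j - 1) (by omega)] at h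
    simpa [one_sub_pow_succ_ne_zero hq (n + 1)] using h

theorem integral_comp_neg_of_periodic {g : ℝ → ℂ} (hg : Function.Periodic g (2 * Real.pi)) :
    ∫ θ in (0 : ℝ)..(2 * Real.pi), g (-θ) = ∫ θ in (0 : ℝ)..(2 * Real.pi), g θ := by
  rw [intervalIntegral.integral_comp_neg, neg_zero]
  have := hg.intervalIntegral_add_eq (-(2 * Real.pi)) 0
  rwa [neg_add_cancel, zero_add] at this

theorem C_inv (hq : ‖q‖ < 1) {z : ℂ} (hz : ‖z‖ = 1) (n : ℕ) :
    C α β q n z⁻¹ = C β α q n z := by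
  rw [C_eq_sum hq hz, C_eq_sum hq (by simp [hz]), ← Finset.Nat.sum_antidiagonal_swap]
  simp only [Prod.fst_swap, Prod.snd_swap, inv_inv]
  exact Finset.sum_congr rfl fun p _ => mul_comm _ _

/-- The reflection `z ↦ z⁻¹` exchanges the two parameters. -/
theorem moment_symm (hq : ‖q‖ < 1) (n : ℕ) (j : ℤ) :
    moment α β q n j = -moment β α q n (-j - 2) := by
  rw [moment, moment, ← integral_comp_neg_of_periodic, ← intervalIntegral.integral_neg]
  · congr 1
    ext θ
    have h0 := expI_ne_zero θ
    have hz : expI θ ^ (-j - 2) = expI θ ^ (-j) * (expI θ ^ 2)⁻¹ := by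
      rw [zpow_sub₀ h0, div_eq_mul_inv]; norm_cast
    rw [expI_neg, C_inv hq (norm_expI θ), inv_pow, psiKernel_inv hq (pow_ne_zero 2 h0), hz,
      inv_zpow, ← zpow_neg]
    ring
  · intro θ
    simp only [periodic_expI θ]

/-- The induction closes on these indices: the recurrence for (n+2, i) involves only (n+1, i+1),
(n+1, i) and (n, i+1), never a moment with j < n. -/
theorem moment_add_two_mul (hq : ‖q‖ < 1) (hα : ‖α‖ < 1) (hβ : ‖β‖ < 1) (n : ℕ) :
    ∀ i : ℕ, moment α β q n (n + 2 * i) =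
      2 * Real.pi * (qPochInf β q / (qPochInf (α * β) q * qPochInf q q)) *
        (qPoch (α * β) q n * qPoch (q ^ (i + 1)) q n / qPoch q q n *
          (∏ l ∈ Finset.range i, (β - q ^ (l + 1))) * qPochInf (α * q ^ (n + i + 1)) q) := by
  have h0 : ∀ i : ℕ, moment α β q 0 (2 * i) =
      2 * Real.pi * (qPochInf β q / (qPochInf (α * β) q * qPochInf q q)) *
        ((∏ l ∈ Finset.range i, (β - q ^ (l + 1))) * qPochInf (α * q ^ (i + 1)) q) :=
    fun i => by rw [moment_zero hq, integral_psiKernel hq hα hβ]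
  set H := 2 * Real.pi * (qPochInf β q / (qPochInf (α * β) q * qPochInf q q))
  have hshift : ∀ m, qPochInf (α * q ^ m) q = (1 - α * q ^ m) * qPochInf (α * q ^ (m + 1)) q :=
    fun m => by rw [qPochInf_eq_one_sub_mul hq, mul_assoc α, ← pow_succ]
  induction n using Nat.twoStepInduction with
  | zero => intro i; simp [h0, qPoch_zero]
  | one =>
    intro i
    have h := moment_one hq hα hβ (1 + 2 * i)
    rw [show (1 + 2 * i + 1 : ℤ) = 2 * ((i + 1 : ℕ) : ℤ) by push_cast; ring,
      show (1 + 2 * i - 1 : ℤ) = 2 * i by ring, h0, h0, Finset.prod_range_succ,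
      hshift (i + 1)] at h
    have h1 := one_sub_ne_zero_of_norm_lt_one hq
    rw [show ((1 : ℕ) : ℤ) = 1 from rfl, ← mul_right_inj' h1, h, qPoch_succ, qPoch_succ, qPoch_succ,
      qPoch_zero, qPoch_zero, qPoch_zero, show 1 + i + 1 = i + 1 + 1 by ring]
    simp only [pow_zero, mul_one, one_mul]
    field_simp
    ring
  | more n ih1 ih2 =>
    intro i
    have h := moment_add_two hq hα hβ n ((n + 2 : ℕ) + 2 * i)
    rw [show (((n + 2 : ℕ) : ℤ) + 2 * i + 1 : ℤ) = (n + 1 : ℕ) + 2 * ((i + 1 : ℕ) : ℤ) by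
        push_cast; ring,
      show (((n + 2 : ℕ) : ℤ) + 2 * i - 1 : ℤ) = (n + 1 : ℕ) + 2 * i by push_cast; ring,
      ih2, ih2] at h
    nth_rewrite 2 [show (((n + 2 : ℕ) : ℤ) + 2 * i : ℤ) = n + 2 * ((i + 1 : ℕ) : ℤ) by
        push_cast; ring] at h
    rw [ih1] at h
    have hE1 : n + 1 + (i + 1) + 1 = n + i + 2 + 1 := by ring
    have hE2 : n + 1 + i + 1 = n + i + 2 := by ring
    have hE3 : n + (i + 1) + 1 = n + i + 2 := by ring
    have hE4 : n + 2 + i + 1 = n + i + 2 + 1 := by ring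
    rw [hE1, hE2, hE3, hshift (n + i + 2), Finset.prod_range_succ] at h
    have h1 := one_sub_pow_succ_ne_zero hq (n + 1)
    have h2 := one_sub_pow_succ_ne_zero hq n
    have h3 := qPoch_ne_zero hq hq n
    have hP : ∀ m, qPoch (q ^ (i + 1)) q (m + 1) = (1 - q ^ (i + 1)) * qPoch (q ^ (i + 1 + 1)) q m :=
      fun m => by rw [qPoch_succ', ← pow_succ]
    rw [← mul_right_inj' h1, h, hE4]
    simp only [hP, qPoch_succ, ← pow_succ']
    simp only [← pow_add]
    set E := qPochInf (α * q ^ (n + i + 2 + 1)) q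
    set B := ∏ l ∈ Finset.range i, (β - q ^ (l + 1))
    set R := qPoch (q ^ (i + 1 + 1)) q n
    field_simp
    ring

/-- On the negative side, the closed form of the moments follows by reflection. -/
theorem moment_neg_sub_two (hq : ‖q‖ < 1) (hα : ‖α‖ < 1) (hβ : ‖β‖ < 1) (n : ℕ) :
    moment α β q n (-n - 2) = -(2 * Real.pi *
      (qPochInf α q / (qPochInf (α * β) q * qPochInf q q)) *
        (qPoch (α * β) q n * qPochInf (β * q ^ (n + 1)) q)) := by
  have h := moment_add_two_mul hq hβ hα n 0
  rw [moment_symm hq, show (-(-n - 2) - 2 : ℤ) = n + 2 * ((0 : ℕ) : ℤ) by push_cast; ring, h,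
    mul_comm β α]
  have := qPoch_ne_zero hq hq n
  simp only [zero_add, pow_one, Finset.prod_range_zero, add_zero, mul_one]
  field_simp

theorem moment_self (hq : ‖q‖ < 1) (hα : ‖α‖ < 1) (hβ : ‖β‖ < 1) (n : ℕ) :
    moment α β q n n = 2 * Real.pi *
      (qPochInf β q / (qPochInf (α * β) q * qPochInf q q)) *
        (qPoch (α * β) q n * qPochInf (α * q ^ (n + 1)) q) := by
  have h := moment_add_two_mul hq hα hβ n 0
  have := qPoch_ne_zero hq hq n
  simp only [zero_add, pow_one, Finset.prod_range_zero, add_zero, mul_one, Nat.cast_zero,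
    mul_zero] at h
  rw [h]
  field_simp

/-- In the recurrence for n + 2, all terms vanish by induction except at j = n and j = -n-2. There
the moments of order n + 1 and n cancel, since (1 - αq^(n+1))(αq^(n+2);q)_∞ = (αq^(n+1);q)_∞, and
likewise for β. -/
theorem moment_eq_zero (hq : ‖q‖ < 1) (hα : ‖α‖ < 1) (hβ : ‖β‖ < 1) (n : ℕ) :
    ∀ j : ℤ, -n ≤ j → j < n → moment α β q n j = 0 := by
  have hshift : ∀ a m, qPochInf (a * q ^ m) q = (1 - a * q ^ m) * qPochInf (a * q ^ (m + 1)) q :=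
    fun a m => by rw [qPochInf_eq_one_sub_mul hq, mul_assoc a, ← pow_succ]
  induction n using Nat.twoStepInduction with
  | zero => intro j h1 h2; push_cast at h1 h2; omega
  | one =>
    intro j h1 h2
    push_cast at h1 h2
    obtain rfl | rfl : j = -1 ∨ j = 0 := by omega
    · have h := moment_one hq hα hβ (-1)
      have e1 := moment_self hq hα hβ 0
      have e2 := moment_neg_sub_two hq hα hβ 0
      have e3 := qPochInf_eq_one_sub_mul hq α
      have e4 := qPochInf_eq_one_sub_mul hq β
      simp only [Nat.cast_zero, neg_zero, zero_sub, zero_add, pow_one, qPoch_zero] at e1 e2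
      rw [show (-1 + 1 : ℤ) = 0 from rfl, show (-1 - 1 : ℤ) = -2 from rfl, e1, e2, e3, e4] at h
      have hh : (1 - q) * moment α β q 1 (-1) = 0 := by rw [h]; ring
      simpa [one_sub_ne_zero_of_norm_lt_one hq] using hh
    · exact moment_eq_zero_of_odd hq hα hβ 1 0 (by decide)
  | more n ih1 ih2 =>
    intro j h1 h2
    by_cases hodd : Odd (((n + 2 : ℕ) : ℤ) + j)
    · exact moment_eq_zero_of_odd hq hα hβ _ j hodd
    rw [Int.not_odd_iff] at hodd
    push_cast at h1 h2 hodd ih2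
    have h := moment_add_two hq hα hβ n j
    suffices hh : (1 - q ^ (n + 2)) * moment α β q (n + 2) j = 0 by
      simpa [one_sub_pow_succ_ne_zero hq (n + 1)] using hh
    rw [h]
    by_cases hj : j = n
    · subst hj
      rw [ih2 (n - 1) (by omega) (by omega), moment_self hq hα hβ]
      have e := moment_self hq hα hβ (n + 1)
      push_cast at e
      rw [e, qPoch_succ, hshift α (n + 1)]
      ring
    by_cases hj' : j = -n - 2
    · subst hj'
      rw [ih2 (-n - 2 + 1) (by omega) (by omega), moment_neg_sub_two hq hα hβ]
      have e := moment_neg_sub_two hq hα hβ (n + 1)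
      rw [show (-((n + 1 : ℕ) : ℤ) - 2 : ℤ) = -n - 2 - 1 by push_cast; ring] at e
      rw [e, qPoch_succ, hshift β (n + 1)]
      ring
    rw [ih1 j (by omega) (by omega), ih2 (j + 1) (by omega) (by omega),
      ih2 (j - 1) (by omega) (by omega)]
    ring

/-! ### Orthogonality and norms -/

theorem continuous_weight (hq : ‖q‖ < 1) (hα : ‖α‖ < 1) (hβ : ‖β‖ < 1) :
    Continuous (weight α β q) := by
  rw [funext (weight_eq hq α β)]
  exact (continuous_const.sub ((continuous_expI.pow 2).inv₀ fun θ =>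
    pow_ne_zero _ (expI_ne_zero θ))).mul (continuous_psiKernel hq hα hβ)

theorem integral_C_mul_weight (hq : ‖q‖ < 1) (hα : ‖α‖ < 1) (hβ : ‖β‖ < 1) (n : ℕ) (j : ℤ) :
    ∫ θ in (0 : ℝ)..(2 * Real.pi), C α β q n (expI θ) * weight α β q θ * expI θ ^ j =
      moment α β q n j - moment α β q n (j - 2) := by
  have hi := fun n j => (continuous_moment_integrand hq hα hβ n j).intervalIntegrable
    (μ := volume) 0 (2 * Real.pi)
  rw [moment, moment, ← intervalIntegral.integral_sub (hi _ _) (hi _ _)]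
  congr 1
  ext θ
  have hz : expI θ ^ (j - 2) = expI θ ^ j * (expI θ ^ 2)⁻¹ := by
    rw [zpow_sub₀ (expI_ne_zero θ), div_eq_mul_inv]; norm_cast
  rw [weight_eq hq, hz]
  ring

theorem integral_C_mul_weight_eq_zero (hq : ‖q‖ < 1) (hα : ‖α‖ < 1) (hβ : ‖β‖ < 1) {n : ℕ}
    {j : ℤ} (h1 : -n < j) (h2 : j < n) :
    ∫ θ in (0 : ℝ)..(2 * Real.pi), C α β q n (expI θ) * weight α β q θ * expI θ ^ j = 0 := by
  rw [integral_C_mul_weight hq hα hβ, moment_eq_zero hq hα hβ n j h1.le h2, zero_sub, neg_eq_zero]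
  -- Here j - 2 = -n - 1 lies just outside the vanishing window, but has the wrong parity.
  by_cases h : j = -n + 1
  · exact moment_eq_zero_of_odd hq hα hβ n _ (by rw [h, Int.odd_iff]; omega)
  · exact moment_eq_zero hq hα hβ n _ (by omega) (by omega)

theorem integral_C_mul_C_eq_sum (hq : ‖q‖ < 1) (hα : ‖α‖ < 1) (hβ : ‖β‖ < 1) (m n : ℕ) :
    ∫ θ in (0 : ℝ)..(2 * Real.pi),
        C α β q m (expI θ) * C α β q n (expI θ) * weight α β q θ =
      ∑ p ∈ Finset.HasAntidiagonal.antidiagonal m, qBinCoeff α 1 q p.1 * qBinCoeff β 1 q p.2 *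
        ∫ θ in (0 : ℝ)..(2 * Real.pi),
          C α β q n (expI θ) * weight α β q θ * expI θ ^ (p.1 - p.2 : ℤ) := by
  simp_rw [← intervalIntegral.integral_const_mul]
  rw [← intervalIntegral.integral_finsetSum fun p _ => ?_]
  · congr 1
    ext θ
    rw [C_eq_sum hq (norm_expI θ) m, Finset.sum_mul, Finset.sum_mul]
    refine Finset.sum_congr rfl fun p _ => ?_
    rw [zpow_sub₀ (expI_ne_zero θ), zpow_natCast, zpow_natCast, inv_pow]
    ring
  · exact (continuous_const.mul (((continuous_C_expI hq α β n).mul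
      (continuous_weight hq hα hβ)).mul (continuous_expI_zpow _))).intervalIntegrable _ _

theorem integral_C_mul_C_of_lt (hq : ‖q‖ < 1) (hα : ‖α‖ < 1) (hβ : ‖β‖ < 1) {m n : ℕ}
    (hmn : m < n) :
    ∫ θ in (0 : ℝ)..(2 * Real.pi),
      C α β q m (expI θ) * C α β q n (expI θ) * weight α β q θ = 0 := by
  rw [integral_C_mul_C_eq_sum hq hα hβ]
  refine Finset.sum_eq_zero fun p hp => ?_
  rw [Finset.HasAntidiagonal.mem_antidiagonal] at hp
  rw [integral_C_mul_weight_eq_zero hq hα hβ (by omega) (by omega), mul_zero]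

/-- Frequency n contributes M(n,n) - M(n,n-2) and frequency -n contributes M(n,-n) - M(n,-n-2). For
n > 0 the inner moments vanish. -/
theorem integral_C_mul_self (hq : ‖q‖ < 1) (hα : ‖α‖ < 1) (hβ : ‖β‖ < 1) (n : ℕ) :
    ∫ θ in (0 : ℝ)..(2 * Real.pi),
        C α β q n (expI θ) * C α β q n (expI θ) * weight α β q θ =
      qPoch α q n / qPoch q q n * moment α β q n n -
        qPoch β q n / qPoch q q n * moment α β q n (-n - 2) := by
  rw [integral_C_mul_C_eq_sum hq hα hβ]
  -- For n = 0 the extreme pairs (n,0) and (0,n) coincide, and the single term already yields both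
  -- moments.
  rcases Nat.eq_zero_or_pos n with rfl | hn
  · simp [integral_C_mul_weight hq hα hβ, qBinCoeff_zero, qPoch_zero]
  rw [Finset.sum_eq_add_of_mem (n, 0) (0, n) (by simp) (by simp) (by simp [hn.ne'])]
  · simp only [qBinCoeff_zero, qBinCoeff_one, integral_C_mul_weight hq hα hβ, Nat.cast_zero,
      sub_zero, zero_sub, mul_one, one_mul]
    rw [moment_eq_zero hq hα hβ n (-n) le_rfl (by omega)]
    have : moment α β q n (n - 2) = 0 := by
      by_cases h : n = 1
      · subst h
        exact moment_eq_zero hq hα hβ 1 _ (by norm_num) (by norm_num)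
      · exact moment_eq_zero hq hα hβ n _ (by omega) (by omega)
    rw [this]
    ring
  · rintro ⟨i, k⟩ hp ⟨h1, h2⟩
    rw [Finset.HasAntidiagonal.mem_antidiagonal] at hp
    simp only [ne_eq, Prod.mk.injEq, not_and] at h1 h2 hp
    rw [integral_C_mul_weight_eq_zero hq hα hβ (by simp only; omega) (by simp only; omega),
      mul_zero]

theorem integral_C_mul_C (hq : ‖q‖ < 1) (hα : ‖α‖ < 1) (hβ : ‖β‖ < 1) (m n : ℕ) :
    ∫ θ in (0 : ℝ)..(2 * Real.pi),
        C α β q m (expI θ) * C α β q n (expI θ) * weight α β q θ =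
      2 * (Real.pi : ℂ) * (qPochInf α q * qPochInf β q) / (qPochInf q q * qPochInf (α * β) q) *
        (1 / (1 - α * q ^ n) + 1 / (1 - β * q ^ n)) *
        (qPoch (α * β) q n / qPoch q q n) * (if m = n then 1 else 0) := by
  rcases lt_trichotomy m n with h | rfl | h
  · rw [integral_C_mul_C_of_lt hq hα hβ h, if_neg h.ne, mul_zero]
  · rw [integral_C_mul_self hq hα hβ, moment_self hq hα hβ, moment_neg_sub_two hq hα hβ,
      if_pos rfl, mul_one]
    -- The product (a;q)_m (aq^(m+1);q)_∞ lacks only the factor 1 - aq^m of (a;q)_∞; this produces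
    -- the denominators in the norm.
    have hs : ∀ a, qPochInf a q = qPoch a q m * (1 - a * q ^ m) * qPochInf (a * q ^ (m + 1)) q :=
      fun a => by rw [← qPoch_succ, ← qPochInf_eq_qPoch_mul hq]
    have h1 := one_sub_mul_pow_ne_zero hq hα m
    have h2 := one_sub_mul_pow_ne_zero hq hβ m
    have e1 : qPochInf α q / (1 - α * q ^ m) = qPoch α q m * qPochInf (α * q ^ (m + 1)) q := by
      rw [hs α, div_eq_iff h1]; ring
    have e2 : qPochInf β q / (1 - β * q ^ m) = qPoch β q m * qPochInf (β * q ^ (m + 1)) q := by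
      rw [hs β, div_eq_iff h2]; ring
    have key : (qPochInf α q * qPochInf β q) * (1 / (1 - α * q ^ m) + 1 / (1 - β * q ^ m)) =
        qPochInf β q * (qPoch α q m * qPochInf (α * q ^ (m + 1)) q) +
          qPochInf α q * (qPoch β q m * qPochInf (β * q ^ (m + 1)) q) := by
      rw [← e1, ← e2]; ring
    linear_combination (-(2 * Real.pi / (qPochInf q q * qPochInf (α * β) q) *
      (qPoch (α * β) q m / qPoch q q m))) * key
  · simp_rw [mul_comm (C α β q m _)]
    rw [integral_C_mul_C_of_lt hq hα hβ h, if_neg h.ne', mul_zero]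

end QOrth

theorem theorem1p3 (q α β : ℂ) (hq : ‖q‖ < 1) (hα : ‖α‖ < 1) (hβ : ‖β‖ < 1) :
    -- the generating function expansion that defines the functions `C_n`
    (∀ (θ : ℝ) (t : ℂ), ‖t‖ < 1 →
      HasSum (fun n : ℕ => QOrth.C α β q n (Complex.exp (Complex.I * θ)) * t ^ n)
        (QOrth.genFun α β q (Complex.exp (Complex.I * θ)) t)) ∧
    -- the orthogonality relation
    ∀ m n : ℕ,
      IntervalIntegrable
        (fun θ : ℝ => QOrth.C α β q m (Complex.exp (Complex.I * θ)) *
          QOrth.C α β q n (Complex.exp (Complex.I * θ)) * QOrth.weight α β q θ)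
        MeasureTheory.volume 0 (2 * Real.pi) ∧
      ∫ θ in (0 : ℝ)..(2 * Real.pi),
          QOrth.C α β q m (Complex.exp (Complex.I * θ)) *
            QOrth.C α β q n (Complex.exp (Complex.I * θ)) * QOrth.weight α β q θ =
        2 * (Real.pi : ℂ) * (QOrth.qPochInf α q * QOrth.qPochInf β q) /
            (QOrth.qPochInf q q * QOrth.qPochInf (α * β) q) *
          (1 / (1 - α * q ^ n) + 1 / (1 - β * q ^ n)) *
          (QOrth.qPoch (α * β) q n / QOrth.qPoch q q n) *
          (if m = n then 1 else 0) :=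
  ⟨fun θ _ ht => QOrth.hasSum_C hq (QOrth.norm_expI θ) ht, fun m n =>
    ⟨(((QOrth.continuous_C_expI hq α β m).mul (QOrth.continuous_C_expI hq α β n)).mul
      (QOrth.continuous_weight hq hα hβ)).intervalIntegrable _ _,
      QOrth.integral_C_mul_C hq hα hβ m n⟩⟩
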